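/- Manifolds are smooth, finite-dimensional, without boundary, Hausdorff and second countable. A \emph{smooth quasiloopoid} $G\rightrightarrows M$ consists of manifolds $G,M$, surjective submersions $\alpha,\beta:G\to M$ (target and source), a smooth embedding $\varepsilon:M\to G$ (its image is the submanifold of units; we identify $M$ with it), and a product $gh\in G$ defined if and only if $\beta(g)=\alpha(h)$, such that $G^{(2)}=\{(g,h)\in G\times G:\beta(g)=\alpha(h)\}$ is a closed embedded submanifold of $G\times G$, the product $G^{(2)}\to G$ is smooth, $g\,\beta(g)=g$ and $\alpha(h)\,h=h$ for all $g,h\in G$ (in particular these products are defined), and for all $g,h\in G$ the translations $l_g:\alpha^{-1}(\beta(g))\to G$, $x\mapsto gx$, and $r_h:\beta^{-1}(\alpha(h))\to G$, $x\mapsto xh$, are injective immersions. It is a \emph{smooth inverse quasiloopoid} if it is equipped with a diffeomorphism $g\mapsto g^{-1}$ of $G$ such that $g^{-1}(gh)$ is defined and equals $h$ whenever $gh$ is defined, and $(hg)g^{-1}$ is defined and equals $h$ whenever $hg$ is defined. An \emph{inverse loop} is a set $L$ with a binary operation all of whose left and right translations are bijections, a two-sided unit $e$, and a map $a\mapsto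 a^{-1}$ with $a^{-1}(ab)=(ba)a^{-1}=b$ for all $a,b\in L$. It is \emph{smooth} if $L$ is a manifold and the multiplication and the inverse are smooth. \textbf{Theorem.} Let $G\rightrightarrows M$ be a smooth inverse quasiloopoid and $m\in M$. Then the fibre $\beta^{-1}(m)$ is an embedded submanifold of $G$ and the restriction $\alpha|_{\beta^{-1}(m)}:\beta^{-1}(m)\to M$ has constant rank. Moreover, the isotropy set $G_m=\alpha^{-1}(m)\cap\beta^{-1}(m)$ is closed under the product and the inverse of $G$, contains the unit $m$, is an embedded submanifold of $G$, and with the inherited product and inverse and with the unit $m$ it is a smooth inverse loop. -/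

import Mathlib

open scoped Manifold ContDiff

noncomputable section

/-! ### Submanifolds and rank -/

/-- A subset `S` of a manifold `X` is an embedded submanifold: with the subspace topology it carries
a smooth structure (necessarily unique) for which the inclusion is a smooth embedding. -/
def IsEmbeddedSubmanifold {E H X : Type*} [NormedAddCommGroup E] [NormedSpace ℝ E]
    [TopologicalSpace H] (I : ModelWithCorners ℝ E H) [TopologicalSpace X] [ChartedSpace H X]
    (S : Set X) : Prop :=
  ∃ (k : ℕ) (_ : ChartedSpace (EuclideanSpace ℝ (Fin k)) S),
    IsManifold (𝓡 k) ∞ S ∧ Manifold.IsSmoothEmbedding (𝓡 k) I ∞ (Subtype.val : S → X)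

/-- For an embedded submanifold `S` of `X`, the restriction of `f` to `S` is an immersion.
Here `S` carries its smooth structure as an embedded submanifold, which is unique; the quantifier
over all such structures ranges over atlases of this one smooth structure. -/
def IsImmersionOnSubmanifold {E H X E' H' Y : Type*} [NormedAddCommGroup E] [NormedSpace ℝ E]
    [TopologicalSpace H] (I : ModelWithCorners ℝ E H) [TopologicalSpace X] [ChartedSpace H X]
    [NormedAddCommGroup E'] [NormedSpace ℝ E']
    [TopologicalSpace H'] (J : ModelWithCorners ℝ E' H') [TopologicalSpace Y] [ChartedSpace H' Y]
    (S : Set X) (f : X → Y) : Prop :=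
  ∀ (k : ℕ) (_ : ChartedSpace (EuclideanSpace ℝ (Fin k)) S),
    IsManifold (𝓡 k) ∞ S → Manifold.IsSmoothEmbedding (𝓡 k) I ∞ (Subtype.val : S → X) →
      Manifold.IsImmersion (𝓡 k) J ∞ (fun x : S => f x)

/-- A smooth map has constant rank: the rank of its differential is the same at all points. -/
def HasConstantRank {E H X E' H' Y : Type*} [NormedAddCommGroup E] [NormedSpace ℝ E]
    [TopologicalSpace H] (I : ModelWithCorners ℝ E H) [TopologicalSpace X] [ChartedSpace H X]
    [NormedAddCommGroup E'] [NormedSpace ℝ E']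
    [TopologicalSpace H'] (J : ModelWithCorners ℝ E' H') [TopologicalSpace Y] [ChartedSpace H' Y]
    (f : X → Y) : Prop :=
  ContMDiff I J ∞ f ∧
    ∃ r : ℕ, ∀ x : X, Module.finrank ℝ (LinearMap.range (mfderiv I J f x).toLinearMap) = r

/-! ### Smooth inverse loops -/

/-- A loop: a quasigroup (all left and right translations are bijections) with a two-sided unit. -/
structure IsLoop {L : Type*} (mul : L → L → L) (e : L) : Prop where
  left_bijective : ∀ a, Function.Bijective (fun x => mul a x)
  right_bijective : ∀ a, Function.Bijective (fun x => mul x a)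
  one_mul : ∀ a, mul e a = a
  mul_one : ∀ a, mul a e = a

/-- An inverse loop: a loop with `a⁻¹ (a b) = (b a) a⁻¹ = b`. -/
structure IsInverseLoop {L : Type*} (mul : L → L → L) (e : L) (inv : L → L) : Prop
    extends IsLoop mul e where
  inv_mul_cancel_left : ∀ a b, mul (inv a) (mul a b) = b
  mul_inv_cancel_right : ∀ a b, mul (mul b a) (inv a) = b

/-- A smooth inverse loop: an inverse loop on a smooth manifold with smooth multiplication and
smooth inverse. -/
structure IsSmoothInverseLoop {E H L : Type*} [NormedAddCommGroup E] [NormedSpace ℝ E]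
    [TopologicalSpace H] (I : ModelWithCorners ℝ E H) [TopologicalSpace L] [ChartedSpace H L]
    (mul : L → L → L) (e : L) (inv : L → L) : Prop extends IsInverseLoop mul e inv where
  isManifold : IsManifold I ∞ L
  contMDiff_mul : ContMDiff (I.prod I) I ∞ (fun p : L × L => mul p.1 p.2)
  contMDiff_inv : ContMDiff I I ∞ inv

/-! ### Smooth quasiloopoids -/

/-- A smooth quasiloopoid `G ⇉ M`. The submanifold of units is the image of the embedding
`ε : M → G`. The product of `g` and `h` is defined if and only if `β g = α h`: only the values of
`mul` at such composable pairs are meaningful and only these are constrained. -/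
structure SmoothQuasiloopoid (n d : ℕ) (G M : Type*)
    [TopologicalSpace G] [ChartedSpace (EuclideanSpace ℝ (Fin n)) G]
    [TopologicalSpace M] [ChartedSpace (EuclideanSpace ℝ (Fin d)) M] where
  /-- the target map -/
  α : G → M
  /-- the source map -/
  β : G → M
  /-- the embedding of the units -/
  ε : M → G
  /-- the partial multiplication, restricted in every use to pairs with `β g = α h` -/
  mul : G → G → G
  α_surjective : Function.Surjective α
  β_surjective : Function.Surjective β
  α_submersion : Manifold.IsSubmersion (𝓡 n) (𝓡 d) ∞ α
  β_submersion : Manifold.IsSubmersion (𝓡 n) (𝓡 d) ∞ β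
  ε_embedding : Manifold.IsSmoothEmbedding (𝓡 d) (𝓡 n) ∞ ε
  /-- the set of composable pairs is closed in `G × G` -/
  isClosed_composable : IsClosed {p : G × G | β p.1 = α p.2}
  /-- the set of composable pairs is an embedded submanifold of `G × G` -/
  submanifold_composable :
    IsEmbeddedSubmanifold ((𝓡 n).prod (𝓡 n)) {p : G × G | β p.1 = α p.2}
  /-- the multiplication is smooth on the submanifold of composable pairs -/
  smooth_mul : ContMDiffOn ((𝓡 n).prod (𝓡 n)) (𝓡 n) ∞ (fun p : G × G => mul p.1 p.2)
    {p : G × G | β p.1 = α p.2}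
  /-- `g β(g)` is defined -/
  α_ε_β : ∀ g, α (ε (β g)) = β g
  /-- `g β(g) = g` -/
  mul_unit : ∀ g, mul g (ε (β g)) = g
  /-- `α(h) h` is defined -/
  β_ε_α : ∀ h, β (ε (α h)) = α h
  /-- `α(h) h = h` -/
  unit_mul : ∀ h, mul (ε (α h)) h = h
  /-- left translations are injective on the `α`-fibre on which they are defined -/
  left_injective : ∀ g, Set.InjOn (fun h => mul g h) {h | α h = β g}
  /-- left translations are immersions -/
  left_immersion : ∀ g, IsImmersionOnSubmanifold (𝓡 n) (𝓡 n) {h | α h = β g} (fun h => mul g h)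
  /-- right translations are injective on the `β`-fibre on which they are defined -/
  right_injective : ∀ h, Set.InjOn (fun g => mul g h) {g | β g = α h}
  /-- right translations are immersions -/
  right_immersion : ∀ h, IsImmersionOnSubmanifold (𝓡 n) (𝓡 n) {g | β g = α h} (fun g => mul g h)

/-- A smooth inverse quasiloopoid: a smooth quasiloopoid with a diffeomorphism `g ↦ g⁻¹` of `G` such
that, for all composable pairs, `g⁻¹ (g h)` is defined and equals `h`, and `(h g) g⁻¹` is defined
and equals `h`. -/
structure SmoothInverseQuasiloopoid (n d : ℕ) (G M : Type*)
    [TopologicalSpace G] [ChartedSpace (EuclideanSpace ℝ (Fin n)) G]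
    [TopologicalSpace M] [ChartedSpace (EuclideanSpace ℝ (Fin d)) M]
    extends SmoothQuasiloopoid n d G M where
  /-- the inversion -/
  inv : Diffeomorph (𝓡 n) (𝓡 n) G G ∞
  β_inv_eq : ∀ g h, β g = α h → β (inv g) = α (mul g h)
  inv_mul_cancel_left : ∀ g h, β g = α h → mul (inv g) (mul g h) = h
  β_mul_eq : ∀ h g, β h = α g → β (mul h g) = α (inv g)
  mul_inv_cancel_right : ∀ h g, β h = α g → mul (mul h g) (inv g) = h

namespace SmoothQuasiloopoid

variable {n d : ℕ} {G M : Type*}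
  [TopologicalSpace G] [ChartedSpace (EuclideanSpace ℝ (Fin n)) G]
  [TopologicalSpace M] [ChartedSpace (EuclideanSpace ℝ (Fin d)) M]

/-- The target fibre `α⁻¹(m)`. -/
def targetFiber (Q : SmoothQuasiloopoid n d G M) (m : M) : Set G := {g | Q.α g = m}

/-- The source fibre `β⁻¹(m)`. -/
def sourceFiber (Q : SmoothQuasiloopoid n d G M) (m : M) : Set G := {g | Q.β g = m}

/-- The isotropy set `G_m`, the intersection of the target and source fibres over `m`. -/
def isotropy (Q : SmoothQuasiloopoid n d G M) (m : M) : Set G :=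
  Q.targetFiber m ∩ Q.sourceFiber m

end SmoothQuasiloopoid

end

/-! At each arrow g consider the common kernel of dα and dβ, whose dimension is `isotropyDim`. A
left translation by g is an immersion of an α-fibre on which α(gx) is constant and β(gx) = β(x), so
its differential embeds the common kernel at h into the one at gh (`isotropyDim_le_mul`). Applied to
g⁻¹g = β(g) and gβ(g) = g, this shows that the dimension at g equals the dimension at the unit β(g);
associativity plays no role (`isotropyDim_eq_unit`). Hence it is constant along a source fibre, and
rank-nullity gives the constant rank of α there.

The isotropy set is a level set of this constant-rank map. Near a point of it, finitely many linear
combinations P of the coordinates of α are chosen so that f = (β, Pα), in coordinates centred at m,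
is a submersion whose kernel is the common kernel. At nearby zeros of f the two kernels still agree,
by dimension, so dα vanishes along the zero set and α is locally constant on it
(`eventually_eq_of_ker_mfderiv_le`). The zero set of f is thus locally the isotropy set, and
`exists_chartedSpace_of_zeroSet` gives the submanifold.

The loop axioms follow from the cancellation laws and (g⁻¹)⁻¹ = g; smoothness of the operations is
inherited through the embedding. -/

open Set Topology Filter

/-! ### Differentials of immersions and submersions -/

section Derivatives

variable {E E' F X Y : Type*} [NormedAddCommGroup E] [NormedSpace ℝ E]
  [NormedAddCommGroup E'] [NormedSpace ℝ E'] [NormedAddCommGroup F] [NormedSpace ℝ F]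
  [TopologicalSpace X] [ChartedSpace E X] [TopologicalSpace Y] [ChartedSpace E' Y]
  {f : X → Y} {x : X}

/-- A smooth map with a local smooth left inverse has an injective differential. -/
theorem mfderiv_injective_of_eventually_leftInverse {g : Y → X}
    (hf : MDifferentiableAt 𝓘(ℝ, E) 𝓘(ℝ, E') f x)
    (hg : MDifferentiableAt 𝓘(ℝ, E') 𝓘(ℝ, E) g (f x))
    (h : ∀ᶠ y in 𝓝 x, g (f y) = y) :
    Function.Injective (mfderiv 𝓘(ℝ, E) 𝓘(ℝ, E') f x) := by
  have h1 : HasMFDerivAt 𝓘(ℝ, E) 𝓘(ℝ, E) (g ∘ f) x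
      ((mfderiv 𝓘(ℝ, E') 𝓘(ℝ, E) g (f x)).comp (mfderiv 𝓘(ℝ, E) 𝓘(ℝ, E') f x)) :=
    hg.hasMFDerivAt.comp x hf.hasMFDerivAt
  have h2 : HasMFDerivAt 𝓘(ℝ, E) 𝓘(ℝ, E) (g ∘ f) x
      (ContinuousLinearMap.id ℝ (TangentSpace 𝓘(ℝ, E) x)) :=
    (hasMFDerivAt_id x).congr_of_eventuallyEq h
  have h3 := hasMFDerivAt_unique h1 h2
  refine Function.LeftInverse.injective (g := mfderiv 𝓘(ℝ, E') 𝓘(ℝ, E) g (f x)) fun v => ?_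
  exact DFunLike.congr_fun h3 v

theorem Manifold.IsImmersionAtOfComplement.mfderiv_injective
    (h : Manifold.IsImmersionAtOfComplement F 𝓘(ℝ, E) 𝓘(ℝ, E') ∞ f x) :
    Function.Injective (mfderiv 𝓘(ℝ, E) 𝓘(ℝ, E') f x) := by
  have hφ := h.mem_domChart_source
  have key : ∀ y ∈ h.domChart.source, (h.equiv.symm (h.codChart (f y))).1 = h.domChart y := by
    intro y hy
    have hy' : h.domChart y ∈ (h.domChart.extend 𝓘(ℝ, E)).target := by
      simpa using h.domChart.map_source hy
    have := h.writtenInCharts hy'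
    simp only [mfld_simps, Function.comp_apply, h.domChart.left_inv hy] at this
    simp [this]
  refine mfderiv_injective_of_eventually_leftInverse
    -- In the normal form u ↦ (u, 0), projecting to the first factor is a left inverse.
    (g := fun y => h.domChart.symm (h.equiv.symm (h.codChart y)).1)
    (h.contMDiffAt.mdifferentiableAt (by simp)) ?_ ?_
  · have h1 : MDifferentiableAt 𝓘(ℝ, E') 𝓘(ℝ, E') h.codChart (f x) :=
      (contMDiffAt_of_mem_maximalAtlas h.codChart_mem_maximalAtlas
        h.mem_codChart_source).mdifferentiableAt (by simp)
    have h2 : MDifferentiableAt 𝓘(ℝ, E') 𝓘(ℝ, E) (fun v : E' => (h.equiv.symm v).1)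
        (h.codChart (f x)) := by
      rw [mdifferentiableAt_iff_differentiableAt]; fun_prop
    have h3 : MDifferentiableAt 𝓘(ℝ, E) 𝓘(ℝ, E) h.domChart.symm
        (h.equiv.symm (h.codChart (f x))).1 := by
      rw [key x hφ]
      exact (contMDiffAt_symm_of_mem_maximalAtlas h.domChart_mem_maximalAtlas
        (h.domChart.map_source hφ)).mdifferentiableAt (by simp)
    exact MDifferentiableAt.comp (f x) (g := h.domChart.symm) h3 (h2.comp (f x) h1)
  · filter_upwards [h.domChart.open_source.mem_nhds hφ] with y hy
    rw [key y hy, h.domChart.left_inv hy]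

theorem Manifold.IsImmersion.mfderiv_injective
    (h : Manifold.IsImmersion 𝓘(ℝ, E) 𝓘(ℝ, E') ∞ f) (x : X) :
    Function.Injective (mfderiv 𝓘(ℝ, E) 𝓘(ℝ, E') f x) :=
  (h.isImmersionOfComplement_complement x).mfderiv_injective

theorem Manifold.IsSubmersionAtOfComplement.mfderiv_surjective
    (h : Manifold.IsSubmersionAtOfComplement F 𝓘(ℝ, E) 𝓘(ℝ, E') ∞ f x) :
    Function.Surjective (mfderiv 𝓘(ℝ, E) 𝓘(ℝ, E') f x) := by
  have hφ := h.mem_domChart_source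
  have hψ := h.mem_codChart_source
  have key : ∀ u ∈ h.domChart.target,
      h.codChart (f (h.domChart.symm u)) = (h.equiv u).1 := by
    intro u hu
    have hu' : u ∈ (h.domChart.extend 𝓘(ℝ, E)).target := by simpa using hu
    simpa using h.writtenInCharts hu'
  -- A local section through x: the complementary coordinate is frozen at its value at x.
  set s : E' → E := fun v => h.equiv.symm (v, (h.equiv (h.domChart x)).2) with hs
  have hs0 : s (h.codChart (f x)) = h.domChart x := by
    have := key _ (h.domChart.map_source hφ)
    rw [h.domChart.left_inv hφ] at this
    simp [hs, this]
  set g : Y → X := fun y => h.domChart.symm (s (h.codChart y)) with hg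
  have hgx : g (f x) = x := by simp only [hg]; rw [hs0, h.domChart.left_inv hφ]
  have hsd : Differentiable ℝ s := by fun_prop
  have h1 : MDifferentiableAt 𝓘(ℝ, E') 𝓘(ℝ, E') h.codChart (f x) :=
    (contMDiffAt_of_mem_maximalAtlas h.codChart_mem_maximalAtlas hψ).mdifferentiableAt (by simp)
  have h2 : MDifferentiableAt 𝓘(ℝ, E') 𝓘(ℝ, E) s (h.codChart (f x)) := by
    rw [mdifferentiableAt_iff_differentiableAt]; exact hsd _
  have h3 : MDifferentiableAt 𝓘(ℝ, E) 𝓘(ℝ, E) h.domChart.symm (s (h.codChart (f x))) := by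
    rw [hs0]
    exact (contMDiffAt_symm_of_mem_maximalAtlas h.domChart_mem_maximalAtlas
      (h.domChart.map_source hφ)).mdifferentiableAt (by simp)
  have hgd : MDifferentiableAt 𝓘(ℝ, E') 𝓘(ℝ, E) g (f x) :=
    MDifferentiableAt.comp (f x) (g := h.domChart.symm) h3 (h2.comp (f x) h1)
  have hfd : MDifferentiableAt 𝓘(ℝ, E) 𝓘(ℝ, E') f (g (f x)) := by
    rw [hgx]; exact h.contMDiffAt.mdifferentiableAt (by simp)
  have hev : ∀ᶠ y in 𝓝 (f x), f (g y) = y := by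
    have hc : ContinuousAt (fun y => s (h.codChart y)) (f x) :=
      hsd.continuous.continuousAt.comp (h.codChart.continuousAt hψ)
    have ht : h.domChart.target ∈ 𝓝 (s (h.codChart (f x))) := by
      rw [hs0]; exact h.domChart.open_target.mem_nhds (h.domChart.map_source hφ)
    filter_upwards [hc ht, h.codChart.open_source.mem_nhds hψ] with y hy hyψ
    have hfg : f (g y) ∈ h.codChart.source :=
      h.source_subset_preimage_source (h.domChart.map_target hy)
    refine h.codChart.injOn hfg hyψ ?_
    rw [hg, key _ hy]
    simp [hs]
  have e1 := hfd.hasMFDerivAt.comp (f x) hgd.hasMFDerivAt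
  have e2 : HasMFDerivAt 𝓘(ℝ, E') 𝓘(ℝ, E') (f ∘ g) (f x)
      (ContinuousLinearMap.id ℝ (TangentSpace 𝓘(ℝ, E') (f x))) :=
    (hasMFDerivAt_id (f x)).congr_of_eventuallyEq hev
  have e3 : ((mfderiv 𝓘(ℝ, E) 𝓘(ℝ, E') f (g (f x)) : E →L[ℝ] E').comp
      (mfderiv 𝓘(ℝ, E') 𝓘(ℝ, E) g (f x) : E' →L[ℝ] E)) = ContinuousLinearMap.id ℝ E' :=
    hasMFDerivAt_unique e1 e2
  rw [hgx] at e3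
  intro v
  exact ⟨(mfderiv 𝓘(ℝ, E') 𝓘(ℝ, E) g (f x) : E' →L[ℝ] E) v, DFunLike.congr_fun e3 v⟩

theorem Manifold.IsSubmersion.mfderiv_surjective
    (h : Manifold.IsSubmersion 𝓘(ℝ, E) 𝓘(ℝ, E') ∞ f) (x : X) :
    Function.Surjective (mfderiv 𝓘(ℝ, E) 𝓘(ℝ, E') f x) :=
  (h.isSubmersionOfComplement_complement x).mfderiv_surjective

end Derivatives

/-! ### Submersions in local coordinates -/

section SliceCharts

variable {E F K X : Type*} [NormedAddCommGroup E] [NormedSpace ℝ E] [FiniteDimensional ℝ E]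
  [NormedAddCommGroup F] [NormedSpace ℝ F] [FiniteDimensional ℝ F]
  [NormedAddCommGroup K] [NormedSpace ℝ K] [FiniteDimensional ℝ K]

/-- A surjective linear map is the second projection in suitable linear coordinates. -/
theorem ContinuousLinearMap.exists_equiv_prod_of_surjective
    (A : E →L[ℝ] F) (hA : Function.Surjective A)
    (hdim : Module.finrank ℝ K + Module.finrank ℝ F = Module.finrank ℝ E) :
    ∃ (q : E →L[ℝ] K) (e : (K × F) ≃L[ℝ] E), ∀ v, e.symm v = (q v, A v) := by
  have hker : Module.finrank ℝ K = Module.finrank ℝ (LinearMap.ker A.toLinearMap) := by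
    have h1 := A.toLinearMap.finrank_range_add_finrank_ker
    rw [LinearMap.range_eq_top.mpr hA, finrank_top] at h1
    omega
  let σ : LinearMap.ker A.toLinearMap ≃L[ℝ] K := ContinuousLinearEquiv.ofFinrankEq hker.symm
  obtain ⟨p, hp⟩ := Submodule.ClosedComplemented.of_finiteDimensional
    (LinearMap.ker A.toLinearMap)
  -- On the kernel of A the projection p is the identity, so p and A together separate vectors.
  let D : E →L[ℝ] K × F := ((σ : _ →L[ℝ] K).comp p).prod A
  have hD : Function.Injective D := by
    refine (injective_iff_map_eq_zero D).mpr fun v hv => ?_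
    have h1 : σ (p v) = 0 := congrArg Prod.fst hv
    have h2 : A v = 0 := congrArg Prod.snd hv
    have h3 : p v = ⟨v, h2⟩ := hp ⟨v, h2⟩
    have h4 : p v = 0 := by simpa using h1
    simpa [h4] using (congrArg Subtype.val h3).symm
  let L : E ≃ₗ[ℝ] K × F :=
    LinearEquiv.ofInjectiveOfFinrankEq D.toLinearMap hD (by rw [Module.finrank_prod, hdim])
  exact ⟨(σ : _ →L[ℝ] K).comp p, L.toContinuousLinearEquiv.symm, fun v => rfl⟩

/-- A smooth map with surjective differential at `a` is the second projection in a smooth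
coordinate system near `a`. -/
theorem exists_openPartialHomeomorph_eq_snd {H : E → F} {V : Set E} {a : E} (hV : IsOpen V)
    (ha : a ∈ V) (hH : ContDiffOn ℝ ∞ H V) (hsurj : Function.Surjective (fderiv ℝ H a))
    (hdim : Module.finrank ℝ K + Module.finrank ℝ F = Module.finrank ℝ E) :
    ∃ (θ : OpenPartialHomeomorph E E) (e : (K × F) ≃L[ℝ] E), a ∈ θ.source ∧ θ.source ⊆ V ∧
      ContDiffOn ℝ ∞ θ θ.source ∧ ContDiffOn ℝ ∞ θ.symm θ.target ∧
      ∀ y ∈ θ.source, (e.symm (θ y)).2 = H y := by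
  obtain ⟨q, e, he⟩ := (fderiv ℝ H a).exists_equiv_prod_of_surjective hsurj hdim
  -- With H replaced by its differential at a, this map would be the identity, so Ψ has derivative 1
  -- at a and the inverse function theorem applies.
  set Ψ : E → E := fun y => e (q y, H y) with hΨdef
  have hΨ : ContDiffOn ℝ ∞ Ψ V := e.contDiff.comp_contDiffOn (q.contDiff.contDiffOn.prodMk hH)
  have hΨat : ∀ y ∈ V, ContDiffAt ℝ ∞ Ψ y := fun y hy => hΨ.contDiffAt (hV.mem_nhds hy)
  have hΨa : HasFDerivAt Ψ ((ContinuousLinearEquiv.refl ℝ E : E ≃L[ℝ] E) : E →L[ℝ] E) a := by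
    have hHa : HasFDerivAt H (fderiv ℝ H a) a :=
      ((hH.contDiffAt (hV.mem_nhds ha)).differentiableAt (by simp)).hasFDerivAt
    have := e.hasFDerivAt.comp a (q.hasFDerivAt.prodMk hHa)
    refine this.congr_fderiv ?_
    ext v
    have := he v
    simp [← this]
  let θ₀ := (hΨat a ha).toOpenPartialHomeomorph Ψ hΨa (by simp)
  have hθ₀ : ∀ y, θ₀ y = Ψ y := fun y => rfl
  -- Smoothness of the inverse is needed on the whole target, so the source is cut down to points
  -- where the differential of Ψ is invertible.
  let W : Set E := V ∩ fderiv ℝ Ψ ⁻¹' range ((↑) : (E ≃L[ℝ] E) → E →L[ℝ] E)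
  have hW : IsOpen W :=
    (hΨ.continuousOn_fderiv_of_isOpen hV (by simp)).isOpen_inter_preimage hV
      ContinuousLinearEquiv.isOpen
  have haW : a ∈ W := ⟨ha, ContinuousLinearEquiv.refl ℝ E, hΨa.fderiv.symm⟩
  let θ := θ₀.restrOpen W hW
  have hθs : θ.source = θ₀.source ∩ W := θ₀.restrOpen_source W hW
  refine ⟨θ, e, ?_, ?_, ?_, ?_, ?_⟩
  · rw [hθs]
    exact ⟨ContDiffAt.mem_toOpenPartialHomeomorph_source _ _ _, haW⟩
  · rw [hθs]
    exact fun y hy => hy.2.1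
  · rw [hθs]
    exact hΨ.mono fun y hy => hy.2.1
  · intro y hy
    have hy' : θ.symm y ∈ θ.source := θ.map_target hy
    rw [hθs] at hy'
    obtain ⟨B, hB⟩ := hy'.2.2
    have hd : HasFDerivAt Ψ (B : E →L[ℝ] E) (θ.symm y) := by
      rw [hB]
      exact ((hΨat _ hy'.2.1).differentiableAt (by simp)).hasFDerivAt
    exact (θ.contDiffAt_symm hy hd (hΨat _ hy'.2.1)).contDiffWithinAt
  · intro y hy
    have : θ y = Ψ y := rfl
    simp [this, hΨdef]

variable [TopologicalSpace X] [ChartedSpace E X] [IsManifold 𝓘(ℝ, E) ∞ X]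

/-- A smooth map with surjective differential at `x` is the second projection in some chart
around `x`. -/
theorem exists_chart_eq_snd {h : X → F} {U : Set X} {x : X} (hU : IsOpen U) (hx : x ∈ U)
    (hh : ContMDiffOn 𝓘(ℝ, E) 𝓘(ℝ, F) ∞ h U)
    (hsurj : Function.Surjective (mfderiv 𝓘(ℝ, E) 𝓘(ℝ, F) h x))
    (hdim : Module.finrank ℝ K + Module.finrank ℝ F = Module.finrank ℝ E) :
    ∃ φ ∈ IsManifold.maximalAtlas 𝓘(ℝ, E) ∞ X, x ∈ φ.source ∧ φ.source ⊆ U ∧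
      ∃ e : (K × F) ≃L[ℝ] E, ∀ y ∈ φ.source, (e.symm (φ y)).2 = h y := by
  set c := chartAt E x with hc
  have hxc : x ∈ c.source := mem_chart_source E x
  have hcA := IsManifold.chart_mem_maximalAtlas (I := 𝓘(ℝ, E)) (n := ∞) x
  set V : Set E := c.target ∩ c.symm ⁻¹' U with hVdef
  have hV : IsOpen V := c.isOpen_inter_preimage_symm hU
  have haV : c x ∈ V := ⟨c.map_source hxc, by simpa [c.left_inv hxc] using hx⟩
  have hH : ContDiffOn ℝ ∞ (h ∘ c.symm) V := by
    rw [← contMDiffOn_iff_contDiffOn]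
    exact hh.comp ((contMDiffOn_symm_of_mem_maximalAtlas hcA).mono inter_subset_left)
      inter_subset_right
  have hmd : MDifferentiableAt 𝓘(ℝ, E) 𝓘(ℝ, F) h x :=
    ((hh.contMDiffAt (hU.mem_nhds hx)).mdifferentiableAt (by simp))
  have hsurj' : Function.Surjective (fderiv ℝ (h ∘ c.symm) (c x)) := by
    have : mfderiv 𝓘(ℝ, E) 𝓘(ℝ, F) h x = fderiv ℝ (h ∘ c.symm) (c x) := by
      simp [mfderiv, hmd, writtenInExtChartAt, mfld_simps, fderivWithin_univ, hc]
      rfl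
    rwa [this] at hsurj
  obtain ⟨θ, e, h1, h2, h3, h4, h5⟩ :=
    exists_openPartialHomeomorph_eq_snd (K := K) hV haV hH hsurj' hdim
  refine ⟨c ≫ₕ θ, ?_, ?_, ?_, e, ?_⟩
  · refine OpenPartialHomeomorph.mem_maximalAtlas_of_contMDiffOn _ ?_ ?_
    · exact (contMDiffOn_iff_contDiffOn.mpr h3).comp
        ((contMDiffOn_of_mem_maximalAtlas hcA).mono (fun y hy => hy.1)) (fun y hy => hy.2)
    · exact (contMDiffOn_symm_of_mem_maximalAtlas hcA).comp
        ((contMDiffOn_iff_contDiffOn.mpr h4).mono (fun y hy => hy.1)) (fun y hy => hy.2)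
  · exact ⟨hxc, h1⟩
  · intro y hy
    have hyU : c.symm (c y) ∈ U := (h2 hy.2).2
    rwa [c.left_inv hy.1] at hyU
  · intro y hy
    have hyH : (e.symm (θ (c y))).2 = h (c.symm (c y)) := h5 _ hy.2
    rwa [c.left_inv hy.1] at hyH

end SliceCharts

/-! ### Embedded submanifolds from slice charts and zero sets -/

section Submanifolds

variable {E F K X : Type*} [NormedAddCommGroup E] [NormedSpace ℝ E]
  [NormedAddCommGroup F] [NormedSpace ℝ F] [NormedAddCommGroup K] [NormedSpace ℝ K]
  [TopologicalSpace X] [ChartedSpace E X]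

variable (E F K) in
/-- A chart of `X` in which the subset `S` is a linear slice `K × {0}` of `K × F`. -/
structure SliceChart (S : Set X) where
  /-- the chart of the ambient manifold -/
  chart : OpenPartialHomeomorph X E
  /-- the linear splitting of the model space -/
  equiv : (K × F) ≃L[ℝ] E
  chart_mem : chart ∈ IsManifold.maximalAtlas 𝓘(ℝ, E) ∞ X
  mem_iff : ∀ y ∈ chart.source, y ∈ S ↔ (equiv.symm (chart y)).2 = 0

namespace SliceChart

variable {S : Set X} (σ : SliceChart E F K S)

theorem equiv_fst_zero {y : X} (hy : y ∈ σ.chart.source) (hyS : y ∈ S) :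
    σ.equiv ((σ.equiv.symm (σ.chart y)).1, 0) = σ.chart y := by
  rw [← (σ.mem_iff y hy).mp hyS, Prod.mk.eta, σ.equiv.apply_symm_apply]

theorem symm_mem {u : K} (hu : σ.equiv (u, 0) ∈ σ.chart.target) :
    σ.chart.symm (σ.equiv (u, 0)) ∈ S := by
  rw [σ.mem_iff _ (σ.chart.map_target hu), σ.chart.right_inv hu, σ.equiv.symm_apply_apply]

open Classical in
/-- The chart of the slice `S` induced by a slice chart of the ambient manifold. -/
noncomputable def restrict (x₀ : S) : OpenPartialHomeomorph S K where
  toFun y := (σ.equiv.symm (σ.chart y)).1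
  -- The value `x₀` off the target is a mere default; it makes the inverse a total map into S.
  invFun u := if hu : σ.equiv (u, 0) ∈ σ.chart.target then
    ⟨σ.chart.symm (σ.equiv (u, 0)), σ.symm_mem hu⟩ else x₀
  source := Subtype.val ⁻¹' σ.chart.source
  target := (fun u => σ.equiv (u, 0)) ⁻¹' σ.chart.target
  map_source' y hy := by
    have hy' : (y : X) ∈ σ.chart.source := hy
    rw [mem_preimage, σ.equiv_fst_zero hy' y.2]
    exact σ.chart.map_source hy'
  map_target' u hu := by
    have hu' : σ.equiv (u, 0) ∈ σ.chart.target := hu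
    simpa only [dif_pos hu', mem_preimage] using σ.chart.map_target hu'
  left_inv' y hy := by
    have hy' : (y : X) ∈ σ.chart.source := hy
    simp only [σ.equiv_fst_zero hy' y.2, dif_pos (σ.chart.map_source hy')]
    exact Subtype.ext (σ.chart.left_inv hy')
  right_inv' u hu := by
    have hu' : σ.equiv (u, 0) ∈ σ.chart.target := hu
    simp only [dif_pos hu', σ.chart.right_inv hu', σ.equiv.symm_apply_apply]
  open_source := σ.chart.open_source.preimage continuous_subtype_val
  open_target := σ.chart.open_target.preimage (by fun_prop)
  continuousOn_toFun := by
    have h : ContinuousOn (fun y : S => σ.chart y) (Subtype.val ⁻¹' σ.chart.source) :=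
      σ.chart.continuousOn.comp continuous_subtype_val.continuousOn fun y hy => hy
    exact continuous_fst.comp_continuousOn (σ.equiv.symm.continuous.comp_continuousOn h)
  continuousOn_invFun := by
    rw [IsInducing.subtypeVal.continuousOn_iff]
    have h : ContinuousOn (fun u : K => σ.chart.symm (σ.equiv (u, 0)))
        ((fun u => σ.equiv (u, 0)) ⁻¹' σ.chart.target) :=
      σ.chart.symm.continuousOn.comp (by fun_prop) fun y hy => hy
    refine h.congr fun u hu => ?_
    have hu' : σ.equiv (u, 0) ∈ σ.chart.target := hu
    simp only [Function.comp_apply, dif_pos hu']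

variable (x₀ : S)

theorem coe_restrict_symm {u : K} (hu : u ∈ (σ.restrict x₀).target) :
    ((σ.restrict x₀).symm u : X) = σ.chart.symm (σ.equiv (u, 0)) := by
  have hu' : σ.equiv (u, 0) ∈ σ.chart.target := hu
  have : (σ.restrict x₀).symm u = ⟨σ.chart.symm (σ.equiv (u, 0)), σ.symm_mem hu'⟩ := dif_pos hu'
  rw [this]

/-- A transition map of slices is the ambient transition map preceded by u ↦ (u, 0) and followed by
the first projection. -/
theorem contDiffOn_restrict_symm_trans (τ : SliceChart E F K S) (y₀ : S) :
    ContDiffOn ℝ ∞ ((σ.restrict x₀).symm ≫ₕ τ.restrict y₀)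
      ((σ.restrict x₀).symm ≫ₕ τ.restrict y₀).source := by
  have h1 : ContDiffOn ℝ ∞ (σ.chart.symm ≫ₕ τ.chart) (σ.chart.symm ≫ₕ τ.chart).source :=
    contMDiffOn_iff_contDiffOn.mp (contMDiffOn_of_mem_contDiffGroupoid
      (IsManifold.compatible_of_mem_maximalAtlas σ.chart_mem τ.chart_mem))
  have h2 : ContDiff ℝ ∞ fun u : K => σ.equiv (u, 0) := by fun_prop
  have h3 : ContDiff ℝ ∞ fun v : E => (τ.equiv.symm v).1 := by fun_prop
  have hs : MapsTo (fun u : K => σ.equiv (u, 0)) ((σ.restrict x₀).symm ≫ₕ τ.restrict y₀).source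
      (σ.chart.symm ≫ₕ τ.chart).source := by
    rintro u ⟨hu1, hu2⟩
    have hu1' : u ∈ (σ.restrict x₀).target := hu1
    refine ⟨hu1', ?_⟩
    have : ((σ.restrict x₀).symm u : X) ∈ τ.chart.source := hu2
    rwa [σ.coe_restrict_symm x₀ hu1'] at this
  refine (h3.comp_contDiffOn (h1.comp h2.contDiffOn hs)).congr fun u hu => ?_
  have hu1 : u ∈ (σ.restrict x₀).target := hu.1
  change (τ.equiv.symm (τ.chart ((σ.restrict x₀).symm u : S))).1 = _
  rw [σ.coe_restrict_symm x₀ hu1]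
  rfl

end SliceChart

/-- A subset covered by slice charts is an embedded submanifold. -/
theorem exists_chartedSpace_of_sliceChart {S : Set X}
    (h : ∀ x ∈ S, ∃ σ : SliceChart E F K S, x ∈ σ.chart.source) :
    ∃ _ : ChartedSpace K S, IsManifold 𝓘(ℝ, K) ∞ S ∧
      Manifold.IsSmoothEmbedding 𝓘(ℝ, K) 𝓘(ℝ, E) ∞ (Subtype.val : S → X) := by
  choose σ hσ using fun x : S => h x x.2
  let cs : ChartedSpace K S :=
    { atlas := range fun x => (σ x).restrict x
      chartAt := fun x => (σ x).restrict x
      mem_chart_source := fun x => hσ x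
      chart_mem_atlas := fun x => mem_range_self x }
  have hM : IsManifold 𝓘(ℝ, K) ∞ S := by
    refine isManifold_of_contDiffOn _ _ _ ?_
    rintro _ _ ⟨x, rfl⟩ ⟨y, rfl⟩
    simpa only [mfld_simps] using (σ x).contDiffOn_restrict_symm_trans x (σ y) y
  refine ⟨cs, hM, ?_, IsEmbedding.subtypeVal⟩
  refine Manifold.IsImmersionOfComplement.isImmersion (F := F) fun x => ?_
  refine Manifold.IsImmersionAtOfComplement.mk_of_charts (σ x).equiv ((σ x).restrict x)
    (σ x).chart (hσ x) (hσ x) (IsManifold.subset_maximalAtlas (mem_range_self x))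
    (σ x).chart_mem (fun y hy => hy) ?_
  intro u hu
  have hu' : u ∈ ((σ x).restrict x).target := by simpa using hu
  simp only [mfld_simps, Function.comp_apply, (σ x).coe_restrict_symm x hu']
  exact (σ x).chart.right_inv hu'

/-- A subset which is locally the zero set of a smooth map with surjective differential is an
embedded submanifold. -/
theorem exists_chartedSpace_of_zeroSet [FiniteDimensional ℝ E] [FiniteDimensional ℝ F]
    [FiniteDimensional ℝ K] [IsManifold 𝓘(ℝ, E) ∞ X] {S : Set X}
    (hdim : Module.finrank ℝ K + Module.finrank ℝ F = Module.finrank ℝ E)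
    (h : ∀ x ∈ S, ∃ (U : Set X) (f : X → F), IsOpen U ∧ x ∈ U ∧
      ContMDiffOn 𝓘(ℝ, E) 𝓘(ℝ, F) ∞ f U ∧
      Function.Surjective (mfderiv 𝓘(ℝ, E) 𝓘(ℝ, F) f x) ∧ ∀ y ∈ U, y ∈ S ↔ f y = 0) :
    ∃ _ : ChartedSpace K S, IsManifold 𝓘(ℝ, K) ∞ S ∧
      Manifold.IsSmoothEmbedding 𝓘(ℝ, K) 𝓘(ℝ, E) ∞ (Subtype.val : S → X) := by
  refine exists_chartedSpace_of_sliceChart (F := F) fun x hx => ?_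
  obtain ⟨U, f, hU, hxU, hf, hsurj, hS⟩ := h x hx
  obtain ⟨φ, hφ, hxφ, hφU, e, he⟩ := exists_chart_eq_snd hU hxU hf hsurj hdim
  exact ⟨⟨φ, e, hφ, fun y hy => by rw [he y hy]; exact hS y (hφU hy)⟩, hxφ⟩

/-- If the differential of `g` vanishes on the kernel of the differential of the submersion `f` at
all zeros of `f`, then `g` is locally constant on the zero set of `f`. -/
theorem eventually_eq_of_ker_mfderiv_le [FiniteDimensional ℝ E] [FiniteDimensional ℝ F]
    [IsManifold 𝓘(ℝ, E) ∞ X]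
    {F' : Type*} [NormedAddCommGroup F'] [NormedSpace ℝ F']
    {f : X → F} {g : X → F'} {U : Set X} {x : X} (hU : IsOpen U) (hxU : x ∈ U)
    (hf : ContMDiffOn 𝓘(ℝ, E) 𝓘(ℝ, F) ∞ f U) (hg : ContMDiffOn 𝓘(ℝ, E) 𝓘(ℝ, F') ∞ g U)
    (hsurj : Function.Surjective (mfderiv 𝓘(ℝ, E) 𝓘(ℝ, F) f x)) (hfx : f x = 0)
    (hker : ∀ y ∈ U, f y = 0 → ∀ v : TangentSpace 𝓘(ℝ, E) y,
      mfderiv 𝓘(ℝ, E) 𝓘(ℝ, F) f y v = 0 → mfderiv 𝓘(ℝ, E) 𝓘(ℝ, F') g y v = 0) :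
    ∀ᶠ y in 𝓝 x, f y = 0 → g y = g x := by
  have hle : Module.finrank ℝ F ≤ Module.finrank ℝ E :=
    LinearMap.finrank_le_finrank_of_surjective
      (f := (mfderiv 𝓘(ℝ, E) 𝓘(ℝ, F) f x : E →L[ℝ] F).toLinearMap) hsurj
  obtain ⟨φ, hφ, hxφ, hφU, e, he⟩ := exists_chart_eq_snd
    (K := EuclideanSpace ℝ (Fin (Module.finrank ℝ E - Module.finrank ℝ F))) hU hxU hf hsurj
    (by rw [finrank_euclideanSpace_fin]; omega)
  set K := EuclideanSpace ℝ (Fin (Module.finrank ℝ E - Module.finrank ℝ F))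
  -- A parametrization of the zero set of f near x.
  set γ : K → X := fun u => φ.symm (e (u, 0)) with hγ
  set W : Set K := (fun u : K => e (u, 0)) ⁻¹' φ.target with hW
  have hWo : IsOpen W := φ.open_target.preimage (by fun_prop)
  have hγs : ∀ u ∈ W, γ u ∈ φ.source := fun u hu => φ.map_target hu
  have hfγ : ∀ u ∈ W, f (γ u) = 0 := by
    intro u hu
    rw [← he _ (hγs u hu), hγ, φ.right_inv hu, e.symm_apply_apply]
  have hγd : ∀ u ∈ W, MDifferentiableAt 𝓘(ℝ, K) 𝓘(ℝ, E) γ u := by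
    intro u hu
    have h1 : MDifferentiableAt 𝓘(ℝ, E) 𝓘(ℝ, E) φ.symm (e (u, 0)) :=
      (contMDiffAt_symm_of_mem_maximalAtlas hφ hu).mdifferentiableAt (by simp)
    have h2 : MDifferentiableAt 𝓘(ℝ, K) 𝓘(ℝ, E) (fun u : K => e (u, 0)) u := by
      rw [mdifferentiableAt_iff_differentiableAt]; fun_prop
    exact MDifferentiableAt.comp u (g := φ.symm) h1 h2
  -- As f ∘ γ vanishes on W, the differential of γ takes values in the kernel of df, where dg
  -- vanishes by hypothesis.
  have hderiv : ∀ u ∈ W, HasFDerivAt (g ∘ γ) (0 : K →L[ℝ] F') u := by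
    intro u hu
    have hUu : U ∈ 𝓝 (γ u) := hU.mem_nhds (hφU (hγs u hu))
    have hfd := ((hf.contMDiffAt hUu).mdifferentiableAt (by simp)).hasMFDerivAt.comp u
      (hγd u hu).hasMFDerivAt
    have hgd := ((hg.contMDiffAt hUu).mdifferentiableAt (by simp)).hasMFDerivAt.comp u
      (hγd u hu).hasMFDerivAt
    have h0 : HasMFDerivAt 𝓘(ℝ, K) 𝓘(ℝ, F) (f ∘ γ) u (0 : K →L[ℝ] F) :=
      (hasMFDerivAt_const (0 : F) u).congr_of_eventuallyEq <| by
        filter_upwards [hWo.mem_nhds hu] with w hw using hfγ w hw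
    have h1 := hasMFDerivAt_unique hfd h0
    refine (hasMFDerivAt_iff_hasFDerivAt.mp hgd).congr_fderiv ?_
    ext1 v
    exact hker _ (hφU (hγs u hu)) (hfγ u hu) (mfderiv 𝓘(ℝ, K) 𝓘(ℝ, E) γ u v)
      (DFunLike.congr_fun h1 v)
  have hx0 : (e.symm (φ x)).2 = 0 := (he x hxφ).trans hfx
  set u₀ : K := (e.symm (φ x)).1 with hu₀
  have heu₀ : e (u₀, 0) = φ x := by
    rw [hu₀, ← hx0, Prod.mk.eta, e.apply_symm_apply]
  have hu₀W : u₀ ∈ W := by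
    rw [hW, mem_preimage, heu₀]; exact φ.map_source hxφ
  -- On a ball, which is convex, a zero derivative forces g ∘ γ to be constant.
  obtain ⟨ε, hε, hball⟩ := Metric.isOpen_iff.mp hWo u₀ hu₀W
  have hcont : ContinuousAt (fun y => (e.symm (φ y)).1) x :=
    continuous_fst.continuousAt.comp
      (e.symm.continuous.continuousAt.comp (φ.continuousAt hxφ))
  filter_upwards [hcont (Metric.ball_mem_nhds u₀ hε), φ.open_source.mem_nhds hxφ]
    with y hy hyφ hfy
  have hconst : (g ∘ γ) (e.symm (φ y)).1 = (g ∘ γ) u₀ := by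
    refine (convex_ball u₀ ε).is_const_of_fderivWithin_eq_zero (𝕜 := ℝ)
      (fun u hu => (hderiv u (hball hu)).differentiableAt.differentiableWithinAt)
      (fun u hu => ?_) hy (Metric.mem_ball_self hε)
    rw [fderivWithin_of_isOpen Metric.isOpen_ball hu, (hderiv u (hball hu)).fderiv]
  have hy0 : (e.symm (φ y)).2 = 0 := (he y hyφ).trans hfy
  have h1 : γ (e.symm (φ y)).1 = y := by
    rw [hγ]
    simp only
    rw [← hy0, Prod.mk.eta, e.apply_symm_apply, φ.left_inv hyφ]
  have h2 : γ u₀ = x := by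
    rw [hγ]
    simp only
    rw [heu₀, φ.left_inv hxφ]
  rwa [Function.comp_apply, Function.comp_apply, h1, h2] at hconst

end Submanifolds

/-! ### Dimension counts for a pair of linear maps -/

section LinearAlgebra

variable {V W : Type*} [NormedAddCommGroup V] [NormedSpace ℝ V] [FiniteDimensional ℝ V]
  [NormedAddCommGroup W] [NormedSpace ℝ W]

theorem Submodule.finrank_map_add_finrank_ker_inf (A : V →ₗ[ℝ] W) (p : Submodule ℝ V) :
    Module.finrank ℝ (p.map A) + Module.finrank ℝ (LinearMap.ker A ⊓ p : Submodule ℝ V) =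
      Module.finrank ℝ p := by
  have h := (A.domRestrict p).finrank_range_add_finrank_ker
  rw [LinearMap.range_domRestrict] at h
  have h2 : (LinearMap.ker (A.domRestrict p)).map p.subtype = LinearMap.ker A ⊓ p := by
    rw [LinearMap.ker_domRestrict, Submodule.map_comap_eq, Submodule.range_subtype, inf_comm]
  rw [← h2, ← (Submodule.equivMapOfInjective p.subtype p.injective_subtype _).finrank_eq]
  exact h

theorem ContinuousLinearMap.finrank_ker_of_surjective {B : V →L[ℝ] W}
    (hB : Function.Surjective B) :
    Module.finrank ℝ (LinearMap.ker B.toLinearMap) + Module.finrank ℝ W = Module.finrank ℝ V := by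
  have h := B.toLinearMap.finrank_range_add_finrank_ker
  rw [LinearMap.range_eq_top.mpr hB, finrank_top] at h
  omega

theorem ContinuousLinearMap.range_eq_ker_of_finrank [FiniteDimensional ℝ W]
    {U : Type*} [NormedAddCommGroup U] [NormedSpace ℝ U] {i : U →L[ℝ] V} {B : V →L[ℝ] W}
    (hi : Function.Injective i) (hB : Function.Surjective B) (hBi : ∀ u, B (i u) = 0)
    (hdim : Module.finrank ℝ U + Module.finrank ℝ W = Module.finrank ℝ V) :
    LinearMap.range i.toLinearMap = LinearMap.ker B.toLinearMap := by
  refine Submodule.eq_of_le_of_finrank_eq (by rintro _ ⟨u, rfl⟩; exact hBi u) ?_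
  rw [LinearMap.finrank_range_of_inj hi]
  have := ContinuousLinearMap.finrank_ker_of_surjective hB
  omega

/-- The common kernel of A and B lies in the image of i; pulling it back along i and pushing it
forward along l loses no dimension and lands in the common kernel of A' and B'. Below, i is the
inclusion of an α-fibre and l a left translation. -/
theorem ContinuousLinearMap.finrank_ker_inf_ker_le {U : Type*} [NormedAddCommGroup U]
    [NormedSpace ℝ U] {i l : U →L[ℝ] V} {A B A' B' : V →L[ℝ] W}
    (hi : Function.Injective i) (hl : Function.Injective l)
    (hiA : LinearMap.range i.toLinearMap = LinearMap.ker A.toLinearMap)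
    (hA : ∀ u, A' (l u) = 0) (hB : ∀ u, B' (l u) = B (i u)) :
    Module.finrank ℝ (LinearMap.ker A.toLinearMap ⊓ LinearMap.ker B.toLinearMap :
      Submodule ℝ V) ≤
    Module.finrank ℝ (LinearMap.ker A'.toLinearMap ⊓ LinearMap.ker B'.toLinearMap :
      Submodule ℝ V) := by
  set p := (LinearMap.ker A.toLinearMap ⊓ LinearMap.ker B.toLinearMap).comap i.toLinearMap with hp
  have h1 : p.map i.toLinearMap = LinearMap.ker A.toLinearMap ⊓ LinearMap.ker B.toLinearMap :=
    Submodule.map_comap_eq_self (by rw [hiA]; exact inf_le_left)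
  rw [← h1, ← (Submodule.equivMapOfInjective i.toLinearMap hi p).finrank_eq,
    (Submodule.equivMapOfInjective l.toLinearMap hl p).finrank_eq]
  refine Submodule.finrank_mono ?_
  rintro _ ⟨u, hu, rfl⟩
  exact ⟨hA u, (hB u).trans hu.2⟩

/-- Rank-nullity for A restricted to the kernel of B, which i parametrizes. It turns constancy of
the common kernel's dimension into constancy of rank. -/
theorem ContinuousLinearMap.finrank_range_comp_add {U : Type*} [NormedAddCommGroup U]
    [NormedSpace ℝ U] [FiniteDimensional ℝ U] {i : U →L[ℝ] V} {A B : V →L[ℝ] W}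
    (hi : Function.Injective i)
    (hiB : LinearMap.range i.toLinearMap = LinearMap.ker B.toLinearMap) :
    Module.finrank ℝ (LinearMap.range (A.comp i).toLinearMap) +
      Module.finrank ℝ (LinearMap.ker A.toLinearMap ⊓ LinearMap.ker B.toLinearMap :
        Submodule ℝ V) = Module.finrank ℝ U := by
  have h1 := Submodule.finrank_map_add_finrank_ker_inf A.toLinearMap (LinearMap.ker B.toLinearMap)
  rw [← hiB, LinearMap.finrank_range_of_inj hi, ← LinearMap.range_comp, hiB] at h1
  exact h1

variable {R : Type*} [NormedAddCommGroup R] [NormedSpace ℝ R] [FiniteDimensional ℝ R]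

/-- If `B` is surjective, then `A` can be cut down to a map `P ∘ A` such that `(B, P ∘ A)` is
surjective with the same kernel as `(B, A)`. -/
theorem ContinuousLinearMap.exists_prod_comp_surjective (A : V →L[ℝ] W) (B : V →L[ℝ] W)
    (hB : Function.Surjective B)
    (hdim : Module.finrank ℝ (LinearMap.ker A.toLinearMap ⊓ LinearMap.ker B.toLinearMap :
      Submodule ℝ V) + (Module.finrank ℝ W + Module.finrank ℝ R) = Module.finrank ℝ V) :
    ∃ P : W →L[ℝ] R, Function.Surjective fun v => (B v, P (A v)) := by
  -- The part of the range of A not controlled by B; the dimension hypothesis says exactly that it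
  -- has the dimension of R.
  set T := (LinearMap.ker B.toLinearMap).map A.toLinearMap with hT
  have h1 := Submodule.finrank_map_add_finrank_ker_inf A.toLinearMap (LinearMap.ker B.toLinearMap)
  have h2 := ContinuousLinearMap.finrank_ker_of_surjective hB
  have hTR : Module.finrank ℝ T = Module.finrank ℝ R := by rw [hT]; omega
  let σ : T ≃L[ℝ] R := ContinuousLinearEquiv.ofFinrankEq hTR
  obtain ⟨p, hp⟩ := Submodule.ClosedComplemented.of_finiteDimensional T
  refine ⟨(σ : T →L[ℝ] R).comp p, fun ⟨w, r⟩ => ?_⟩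
  obtain ⟨v, rfl⟩ := hB w
  obtain ⟨v', hv', hv'A⟩ := (σ.symm r - p (A v)).2
  -- The correction v' lies in the kernel of B, so it adjusts the R-component alone.
  refine ⟨v + v', Prod.ext ?_ ?_⟩
  · have : B v' = 0 := hv'
    simp [this]
  · have h3 : A v' = (σ.symm r - p (A v) : T) := hv'A
    have h4 : p (A v') = σ.symm r - p (A v) := by rw [h3, hp]
    simp [h4]

end LinearAlgebra

/-! ### Centred charts and openness of the submersion condition -/

section Charts

variable {E X : Type*} [NormedAddCommGroup E] [NormedSpace ℝ E]
  [TopologicalSpace X] [ChartedSpace E X]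

theorem exists_chart_eq_zero [IsManifold 𝓘(ℝ, E) ∞ X] (x : X) :
    ∃ φ ∈ IsManifold.maximalAtlas 𝓘(ℝ, E) ∞ X, x ∈ φ.source ∧ φ x = 0 := by
  have hc := IsManifold.chart_mem_maximalAtlas (I := 𝓘(ℝ, E)) (n := ∞) x
  set c := chartAt E x
  refine ⟨c ≫ₕ (Homeomorph.subRight (c x)).toOpenPartialHomeomorph,
    OpenPartialHomeomorph.mem_maximalAtlas_of_contMDiffOn _ ?_ ?_, ?_, ?_⟩
  · have h : ContMDiff 𝓘(ℝ, E) 𝓘(ℝ, E) ∞ fun v : E => v - c x := by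
      rw [contMDiff_iff_contDiff]; fun_prop
    exact (h.comp_contMDiffOn (contMDiffOn_of_mem_maximalAtlas hc)).mono fun y hy => hy.1
  · have h : ContMDiff 𝓘(ℝ, E) 𝓘(ℝ, E) ∞ fun v : E => v + c x := by
      rw [contMDiff_iff_contDiff]; fun_prop
    exact (contMDiffOn_symm_of_mem_maximalAtlas hc).comp h.contMDiffOn fun y hy => hy.2
  · simp [c]
  · simp

variable [FiniteDimensional ℝ E]

instance TangentSpace.finiteDimensional (x : X) :
    FiniteDimensional ℝ (TangentSpace 𝓘(ℝ, E) x) :=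
  inferInstanceAs (FiniteDimensional ℝ E)

theorem mfderiv_bijective_of_mem_maximalAtlas {φ : OpenPartialHomeomorph X E}
    (hφ : φ ∈ IsManifold.maximalAtlas 𝓘(ℝ, E) ∞ X) {x : X} (hx : x ∈ φ.source) :
    Function.Bijective (mfderiv 𝓘(ℝ, E) 𝓘(ℝ, E) φ x) := by
  have h : Function.Injective (mfderiv 𝓘(ℝ, E) 𝓘(ℝ, E) φ x) :=
    mfderiv_injective_of_eventually_leftInverse (g := φ.symm)
      ((contMDiffAt_of_mem_maximalAtlas hφ hx).mdifferentiableAt (by simp))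
      ((contMDiffAt_symm_of_mem_maximalAtlas hφ (φ.map_source hx)).mdifferentiableAt (by simp))
      (by filter_upwards [φ.open_source.mem_nhds hx] with y hy using φ.left_inv hy)
  exact ⟨h, LinearMap.surjective_of_injective
    (f := (mfderiv 𝓘(ℝ, E) 𝓘(ℝ, E) φ x : E →L[ℝ] E).toLinearMap) h⟩

variable [IsManifold 𝓘(ℝ, E) ∞ X]
  {F : Type*} [NormedAddCommGroup F] [NormedSpace ℝ F] [FiniteDimensional ℝ F]

/-- The set of points where a smooth map has surjective differential is open. -/
theorem eventually_surjective_mfderiv {h : X → F} {U : Set X} {x : X} (hU : IsOpen U) (hx : x ∈ U)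
    (hh : ContMDiffOn 𝓘(ℝ, E) 𝓘(ℝ, F) ∞ h U)
    (hsurj : Function.Surjective (mfderiv 𝓘(ℝ, E) 𝓘(ℝ, F) h x)) :
    ∀ᶠ y in 𝓝 x, Function.Surjective (mfderiv 𝓘(ℝ, E) 𝓘(ℝ, F) h y) := by
  have hle : Module.finrank ℝ F ≤ Module.finrank ℝ E :=
    LinearMap.finrank_le_finrank_of_surjective
      (f := (mfderiv 𝓘(ℝ, E) 𝓘(ℝ, F) h x : E →L[ℝ] F).toLinearMap) hsurj
  obtain ⟨φ, hφ, hxφ, -, e, he⟩ := exists_chart_eq_snd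
    (K := EuclideanSpace ℝ (Fin (Module.finrank ℝ E - Module.finrank ℝ F))) hU hx hh hsurj
    (by rw [finrank_euclideanSpace_fin]; omega)
  set K := EuclideanSpace ℝ (Fin (Module.finrank ℝ E - Module.finrank ℝ F))
  filter_upwards [φ.open_source.mem_nhds hxφ] with y hy
  -- In the adapted chart h is this surjective linear map, at every point of the chart and not just
  -- at x.
  let L : E →L[ℝ] F := (ContinuousLinearMap.snd ℝ K F).comp e.symm.toContinuousLinearMap
  have hL : Function.Surjective L := Prod.snd_surjective.comp e.symm.surjective
  have h1 := L.hasMFDerivAt.comp y ((contMDiffAt_of_mem_maximalAtlas hφ hy).mdifferentiableAt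
    (by simp)).hasMFDerivAt
  have h2 : h =ᶠ[𝓝 y] L ∘ φ := by
    filter_upwards [φ.open_source.mem_nhds hy] with z hz using (he z hz).symm
  rw [(h1.congr_of_eventuallyEq h2).mfderiv]
  exact hL.comp (mfderiv_bijective_of_mem_maximalAtlas hφ hy).2

end Charts

/-! ### Fibres of submersions and their tangent spaces -/

section Fibers

variable {n d : ℕ} {G M : Type*}
  [TopologicalSpace G] [ChartedSpace (EuclideanSpace ℝ (Fin n)) G]
  [TopologicalSpace M] [ChartedSpace (EuclideanSpace ℝ (Fin d)) M]
  {f : G → M}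

/-- The tangent space of a fibre of a submersion is the kernel of the differential. -/
theorem Manifold.IsSubmersion.range_mfderiv_subtype_val
    (hf : Manifold.IsSubmersion (𝓡 n) (𝓡 d) ∞ f) {k : ℕ} (hk : k + d = n) {m : M}
    [ChartedSpace (EuclideanSpace ℝ (Fin k)) {g | f g = m}]
    (hι : Manifold.IsSmoothEmbedding (𝓡 k) (𝓡 n) ∞ (Subtype.val : {g | f g = m} → G))
    (x : {g | f g = m}) :
    LinearMap.range (mfderiv (𝓡 k) (𝓡 n) (Subtype.val : {g | f g = m} → G) x :
        EuclideanSpace ℝ (Fin k) →L[ℝ] EuclideanSpace ℝ (Fin n)).toLinearMap =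
      LinearMap.ker (mfderiv (𝓡 n) (𝓡 d) f x.1 :
        EuclideanSpace ℝ (Fin n) →L[ℝ] EuclideanSpace ℝ (Fin d)).toLinearMap := by
  refine ContinuousLinearMap.range_eq_ker_of_finrank (U := EuclideanSpace ℝ (Fin k))
    (V := EuclideanSpace ℝ (Fin n)) (W := EuclideanSpace ℝ (Fin d))
    (i := mfderiv (𝓡 k) (𝓡 n) (Subtype.val : {g | f g = m} → G) x)
    (B := mfderiv (𝓡 n) (𝓡 d) f x.1) (hι.isImmersion.mfderiv_injective x)
    (hf.mfderiv_surjective x.1) (fun v => ?_) (by simpa only [finrank_euclideanSpace_fin])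
  have h1 := (hf.contMDiff.mdifferentiable (by simp) x.1).hasMFDerivAt.comp x
    (hι.contMDiff.mdifferentiable (by simp) x).hasMFDerivAt
  -- Constancy of f on the fibre gives one inclusion; equality of dimensions gives the other.
  have h2 : f ∘ (Subtype.val : {g | f g = m} → G) = fun _ => m := funext fun y => y.2
  rw [h2] at h1
  exact DFunLike.congr_fun (hasMFDerivAt_unique h1 (hasMFDerivAt_const m x)) v

variable [IsManifold (𝓡 n) ∞ G] [IsManifold (𝓡 d) ∞ M]

/-- The fibres of a submersion are embedded submanifolds. -/
theorem Manifold.IsSubmersion.exists_chartedSpace_fiber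
    (hf : Manifold.IsSubmersion (𝓡 n) (𝓡 d) ∞ f) {k : ℕ} (hk : k + d = n) (m : M) :
    ∃ _ : ChartedSpace (EuclideanSpace ℝ (Fin k)) {g | f g = m},
      IsManifold (𝓡 k) ∞ {g | f g = m} ∧
      Manifold.IsSmoothEmbedding (𝓡 k) (𝓡 n) ∞ (Subtype.val : {g | f g = m} → G) := by
  refine exists_chartedSpace_of_zeroSet (F := EuclideanSpace ℝ (Fin d))
    (by simpa only [finrank_euclideanSpace_fin]) fun x hx => ?_
  obtain ⟨φ, hφ, hmφ, hφm⟩ := exists_chart_eq_zero (E := EuclideanSpace ℝ (Fin d)) m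
  have hx' : f x = m := hx
  have hxφ : f x ∈ φ.source := by rwa [hx']
  refine ⟨f ⁻¹' φ.source, φ ∘ f, φ.open_source.preimage hf.contMDiff.continuous, hxφ,
    (contMDiffOn_of_mem_maximalAtlas hφ).comp hf.contMDiff.contMDiffOn fun y hy => hy, ?_, ?_⟩
  · have h1 := ((contMDiffAt_of_mem_maximalAtlas hφ hxφ).mdifferentiableAt
      (by simp)).hasMFDerivAt.comp x (hf.contMDiff.mdifferentiable (by simp) x).hasMFDerivAt
    rw [h1.mfderiv]
    exact (mfderiv_bijective_of_mem_maximalAtlas hφ hxφ).2.comp (hf.mfderiv_surjective x)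
  · intro y hy
    rw [Function.comp_apply, ← hφm]
    exact ⟨fun h => congrArg φ h, fun h => φ.injOn hy hmφ h⟩

end Fibers

namespace SmoothInverseQuasiloopoid

/-! ### Algebra of inverse quasiloopoids and the isotropy loop -/

section Algebra

variable {n d : ℕ} {G M : Type*}
  [TopologicalSpace G] [ChartedSpace (EuclideanSpace ℝ (Fin n)) G]
  [TopologicalSpace M] [ChartedSpace (EuclideanSpace ℝ (Fin d)) M]
  (Q : SmoothInverseQuasiloopoid n d G M)

/-- Definedness of g⁻¹(gh), read off at the unit h = β(g). -/
theorem β_inv (g : G) : Q.β (Q.inv g) = Q.α g := by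
  rw [Q.β_inv_eq g (Q.ε (Q.β g)) (Q.α_ε_β g).symm, Q.mul_unit]

theorem α_inv (g : G) : Q.α (Q.inv g) = Q.β g := by
  rw [← Q.β_mul_eq (Q.ε (Q.α g)) g (Q.β_ε_α g), Q.unit_mul]

theorem α_mul {g h : G} (hgh : Q.β g = Q.α h) : Q.α (Q.mul g h) = Q.α g := by
  rw [← Q.β_inv_eq g h hgh, Q.β_inv]

theorem β_mul {g h : G} (hgh : Q.β g = Q.α h) : Q.β (Q.mul g h) = Q.β h := by
  rw [Q.β_mul_eq g h hgh, Q.α_inv]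

theorem inv_mul_self (g : G) : Q.mul (Q.inv g) g = Q.ε (Q.β g) := by
  have := Q.inv_mul_cancel_left g (Q.ε (Q.β g)) (Q.α_ε_β g).symm
  rwa [Q.mul_unit] at this

/-- Since g⁻¹g is the unit β(g), the law (g⁻¹)⁻¹(g⁻¹g) = g has left side (g⁻¹)⁻¹. -/
theorem inv_inv (g : G) : Q.inv (Q.inv g) = g := by
  have h := Q.inv_mul_cancel_left (Q.inv g) g (Q.β_inv g)
  rw [Q.inv_mul_self g] at h
  have h2 := Q.mul_unit (Q.inv (Q.inv g))
  rw [Q.β_inv, Q.α_inv, h] at h2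
  exact h2.symm

theorem α_ε (m : M) : Q.α (Q.ε m) = m := by
  obtain ⟨g, rfl⟩ := Q.β_surjective m
  exact Q.α_ε_β g

theorem β_ε (m : M) : Q.β (Q.ε m) = m := by
  obtain ⟨g, rfl⟩ := Q.α_surjective m
  exact Q.β_ε_α g

theorem mul_mem_isotropy {m : M} {a b : G} (ha : a ∈ Q.isotropy m) (hb : b ∈ Q.isotropy m) :
    Q.mul a b ∈ Q.isotropy m := by
  have h : Q.β a = Q.α b := ha.2.trans hb.1.symm
  exact ⟨(Q.α_mul h).trans ha.1, (Q.β_mul h).trans hb.2⟩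

theorem inv_mem_isotropy {m : M} {a : G} (ha : a ∈ Q.isotropy m) : Q.inv a ∈ Q.isotropy m :=
  ⟨(Q.α_inv a).trans ha.2, (Q.β_inv a).trans ha.1⟩

theorem unit_mem_isotropy (m : M) : Q.ε m ∈ Q.isotropy m := ⟨Q.α_ε m, Q.β_ε m⟩

/-- The cancellation laws make translation by a⁻¹ a one-sided inverse of translation by a; the same
laws for a⁻¹, with (a⁻¹)⁻¹ = a, make it two-sided. -/
theorem isInverseLoop_isotropy (m : M) :
    IsInverseLoop (fun a b : Q.isotropy m => ⟨Q.mul a b, Q.mul_mem_isotropy a.2 b.2⟩)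
      ⟨Q.ε m, Q.unit_mem_isotropy m⟩ (fun a => ⟨Q.inv a, Q.inv_mem_isotropy a.2⟩) := by
  have comp : ∀ a b : Q.isotropy m, Q.β a = Q.α b := fun a b => a.2.2.trans b.2.1.symm
  have inv_mem : ∀ a : Q.isotropy m, Q.inv a ∈ Q.isotropy m := fun a => Q.inv_mem_isotropy a.2
  have hl : ∀ a b : Q.isotropy m, Q.mul (Q.inv a) (Q.mul a b) = b := fun a b =>
    Q.inv_mul_cancel_left a b (comp a b)
  have hr : ∀ a b : Q.isotropy m, Q.mul (Q.mul b a) (Q.inv a) = b := fun a b =>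
    Q.mul_inv_cancel_right b a (comp b a)
  have hl' : ∀ a b : Q.isotropy m, Q.mul a (Q.mul (Q.inv a) b) = b := fun a b => by
    simpa only [Q.inv_inv] using hl ⟨Q.inv a, inv_mem a⟩ b
  have hr' : ∀ a b : Q.isotropy m, Q.mul (Q.mul b (Q.inv a)) a = b := fun a b => by
    simpa only [Q.inv_inv] using hr ⟨Q.inv a, inv_mem a⟩ b
  refine
    { left_bijective := fun a => Function.bijective_iff_has_inverse.mpr
        ⟨fun b => ⟨Q.mul (Q.inv a) b, Q.mul_mem_isotropy (inv_mem a) b.2⟩,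
          fun b => Subtype.ext (hl a b), fun b => Subtype.ext (hl' a b)⟩
      right_bijective := fun a => Function.bijective_iff_has_inverse.mpr
        ⟨fun b => ⟨Q.mul b (Q.inv a), Q.mul_mem_isotropy b.2 (inv_mem a)⟩,
          fun b => Subtype.ext (hr a b), fun b => Subtype.ext (hr' a b)⟩
      one_mul := fun a => Subtype.ext ?_
      mul_one := fun a => Subtype.ext ?_
      inv_mul_cancel_left := fun a b => Subtype.ext (hl a b)
      mul_inv_cancel_right := fun a b => Subtype.ext (hr a b) }
  · have h := Q.unit_mul a
    rwa [show Q.α a = m from a.2.1] at h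
  · have h := Q.mul_unit a
    rwa [show Q.β a = m from a.2.2] at h

/-- For any structure of embedded submanifold on the isotropy set, the inherited operations form
a smooth inverse loop. -/
theorem isSmoothInverseLoop_isotropy (m : M) {k : ℕ}
    [ChartedSpace (EuclideanSpace ℝ (Fin k)) (Q.isotropy m)] [hM : IsManifold (𝓡 k) ∞ (Q.isotropy m)]
    (hι : Manifold.IsSmoothEmbedding (𝓡 k) (𝓡 n) ∞ (Subtype.val : Q.isotropy m → G)) :
    IsSmoothInverseLoop (𝓡 k)
      (fun a b : Q.isotropy m => ⟨Q.mul a b, Q.mul_mem_isotropy a.2 b.2⟩)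
      ⟨Q.ε m, Q.unit_mem_isotropy m⟩ (fun a => ⟨Q.inv a, Q.inv_mem_isotropy a.2⟩) := by
  refine { Q.isInverseLoop_isotropy m with isManifold := hM, contMDiff_mul := ?_, contMDiff_inv := ?_ }
  · have h1 : ContMDiff ((𝓡 k).prod (𝓡 k)) ((𝓡 n).prod (𝓡 n)) ∞
        (fun p : Q.isotropy m × Q.isotropy m => ((p.1 : G), (p.2 : G))) :=
      (hι.contMDiff.comp contMDiff_fst).prodMk (hι.contMDiff.comp contMDiff_snd)
    have h2 : ContMDiff ((𝓡 k).prod (𝓡 k)) (𝓡 n) ∞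
        (fun p : Q.isotropy m × Q.isotropy m => Q.mul p.1 p.2) :=
      Q.smooth_mul.comp_contMDiff h1 fun p => p.1.2.2.trans p.2.2.1.symm
    -- A continuous map into the submanifold is smooth as soon as it is smooth into G.
    exact (ContMDiff.iff_comp_isImmersion hι.isImmersion).mpr
      ⟨h2.continuous.subtype_mk _, h2⟩
  · have h : ContMDiff (𝓡 k) (𝓡 n) ∞ (fun a : Q.isotropy m => Q.inv a) :=
      Q.inv.contMDiff.comp hι.contMDiff
    exact (ContMDiff.iff_comp_isImmersion hι.isImmersion).mpr ⟨h.continuous.subtype_mk _, h⟩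

end Algebra

/-! ### Constant rank and the isotropy submanifold -/

section Isotropy

variable {n d : ℕ} {G M : Type*}
  [TopologicalSpace G] [ChartedSpace (EuclideanSpace ℝ (Fin n)) G]
  [TopologicalSpace M] [ChartedSpace (EuclideanSpace ℝ (Fin d)) M]
  (Q : SmoothInverseQuasiloopoid n d G M)

/-- The differential of the target map. -/
noncomputable def dα (g : G) : EuclideanSpace ℝ (Fin n) →L[ℝ] EuclideanSpace ℝ (Fin d) :=
  mfderiv (𝓡 n) (𝓡 d) Q.α g

/-- The differential of the source map. -/
noncomputable def dβ (g : G) : EuclideanSpace ℝ (Fin n) →L[ℝ] EuclideanSpace ℝ (Fin d) :=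
  mfderiv (𝓡 n) (𝓡 d) Q.β g

theorem hasMFDerivAt_α (g : G) : HasMFDerivAt (𝓡 n) (𝓡 d) Q.α g (Q.dα g) :=
  (Q.α_submersion.contMDiff.mdifferentiable (by simp) g).hasMFDerivAt

theorem hasMFDerivAt_β (g : G) : HasMFDerivAt (𝓡 n) (𝓡 d) Q.β g (Q.dβ g) :=
  (Q.β_submersion.contMDiff.mdifferentiable (by simp) g).hasMFDerivAt

theorem dβ_surjective (g : G) : Function.Surjective (Q.dβ g) := Q.β_submersion.mfderiv_surjective g

/-- The dimension of the common kernel of the differentials of the target and source maps. -/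
noncomputable def isotropyDim (g : G) : ℕ :=
  Module.finrank ℝ (LinearMap.ker (Q.dα g).toLinearMap ⊓ LinearMap.ker (Q.dβ g).toLinearMap :
    Submodule ℝ (EuclideanSpace ℝ (Fin n)))

theorem finrank_ker_dβ (g : G) : Module.finrank ℝ (LinearMap.ker (Q.dβ g).toLinearMap) + d = n := by
  simpa only [finrank_euclideanSpace_fin] using
    ContinuousLinearMap.finrank_ker_of_surjective (Q.dβ_surjective g)

/-- The unit at m provides a point of G at which to count dimensions; thereafter n - d is a true
difference. -/
theorem dim_le (Q : SmoothInverseQuasiloopoid n d G M) (m : M) : d ≤ n := by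
  have := Q.finrank_ker_dβ (Q.ε m)
  omega

theorem isotropyDim_add_le (g : G) : Q.isotropyDim g + d ≤ n := by
  have h1 := Q.finrank_ker_dβ g
  have h2 : Q.isotropyDim g ≤ Module.finrank ℝ (LinearMap.ker (Q.dβ g).toLinearMap) :=
    Submodule.finrank_mono inf_le_right
  omega

variable [IsManifold (𝓡 n) ∞ G] [IsManifold (𝓡 d) ∞ M]

/-- Along x ↦ gx the map α is constant and β is preserved, so the injective differential carries the
common kernel at h into the one at gh. -/
theorem isotropyDim_le_mul {g h : G} (hgh : Q.β g = Q.α h) :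
    Q.isotropyDim h ≤ Q.isotropyDim (Q.mul g h) := by
  have hk : n - d + d = n := Nat.sub_add_cancel (Q.dim_le (Q.β g))
  obtain ⟨cs, hM, hι⟩ := Q.α_submersion.exists_chartedSpace_fiber hk (Q.β g)
  have hl := Q.left_immersion g (n - d) cs hM hι
  let x : {x | Q.α x = Q.β g} := ⟨h, hgh.symm⟩
  have hi' := (hι.contMDiff.mdifferentiable (by simp) x).hasMFDerivAt
  have hl' := (hl.contMDiff.mdifferentiable (by simp) x).hasMFDerivAt
  refine ContinuousLinearMap.finrank_ker_inf_ker_le (U := EuclideanSpace ℝ (Fin (n - d)))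
    (i := mfderiv (𝓡 (n - d)) (𝓡 n) (Subtype.val : {x | Q.α x = Q.β g} → G) x)
    (l := mfderiv (𝓡 (n - d)) (𝓡 n) (fun y : {x | Q.α x = Q.β g} => Q.mul g y) x)
    (hι.isImmersion.mfderiv_injective x) (hl.mfderiv_injective x)
    (Q.α_submersion.range_mfderiv_subtype_val hk hι x) ?_ ?_
  · intro u
    have h1 := (Q.hasMFDerivAt_α (Q.mul g h)).comp x hl'
    have h2 : Q.α ∘ (fun y : {x | Q.α x = Q.β g} => Q.mul g y) = fun _ => Q.α g :=
      funext fun y => Q.α_mul y.2.symm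
    rw [h2] at h1
    exact DFunLike.congr_fun (hasMFDerivAt_unique h1 (hasMFDerivAt_const _ x)) u
  · intro u
    have h1 := (Q.hasMFDerivAt_β (Q.mul g h)).comp x hl'
    have h2 : Q.β ∘ (fun y : {x | Q.α x = Q.β g} => Q.mul g y) = Q.β ∘ Subtype.val :=
      funext fun y => Q.β_mul y.2.symm
    rw [h2] at h1
    exact DFunLike.congr_fun (hasMFDerivAt_unique h1 ((Q.hasMFDerivAt_β h).comp x hi')) u

/-- The products g⁻¹g = β(g) and gβ(g) = g give the two inequalities. -/
theorem isotropyDim_eq_unit (g : G) : Q.isotropyDim g = Q.isotropyDim (Q.ε (Q.β g)) := by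
  refine le_antisymm ?_ ?_
  · have := Q.isotropyDim_le_mul (Q.β_inv g)
    rwa [Q.inv_mul_self] at this
  · have := Q.isotropyDim_le_mul (Q.α_ε_β g).symm
    rwa [Q.mul_unit] at this

/-- The restriction of the target map to a source fibre has constant rank. -/
theorem hasConstantRank_sourceFiber (m : M) {l : ℕ} (hl : l + d = n)
    [ChartedSpace (EuclideanSpace ℝ (Fin l)) (Q.sourceFiber m)]
    (hι : Manifold.IsSmoothEmbedding (𝓡 l) (𝓡 n) ∞ (Subtype.val : Q.sourceFiber m → G)) :
    HasConstantRank (𝓡 l) (𝓡 d) (fun g : Q.sourceFiber m => Q.α g) := by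
  refine ⟨Q.α_submersion.contMDiff.comp hι.contMDiff, l - Q.isotropyDim (Q.ε m), fun x => ?_⟩
  let _ : ChartedSpace (EuclideanSpace ℝ (Fin l)) {g | Q.β g = m} :=
    inferInstanceAs (ChartedSpace (EuclideanSpace ℝ (Fin l)) (Q.sourceFiber m))
  have h1 := (Q.hasMFDerivAt_α x.1).comp x
    (hι.contMDiff.mdifferentiable (by simp) x).hasMFDerivAt
  have h2 := ContinuousLinearMap.finrank_range_comp_add (U := EuclideanSpace ℝ (Fin l))
    (i := mfderiv (𝓡 l) (𝓡 n) (Subtype.val : Q.sourceFiber m → G) x) (A := Q.dα x)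
    (B := Q.dβ x) (hι.isImmersion.mfderiv_injective x)
    (Q.β_submersion.range_mfderiv_subtype_val hl hι x)
  have h3 : Q.isotropyDim x = Q.isotropyDim (Q.ε m) := by
    rw [Q.isotropyDim_eq_unit, show Q.β x = m from x.2]
  rw [finrank_euclideanSpace_fin] at h2
  rw [← h3]
  have h4 : mfderiv (𝓡 l) (𝓡 d) (fun g : Q.sourceFiber m => Q.α g) x = _ := h1.mfderiv
  rw [h4]
  exact Nat.eq_sub_of_add_eq h2

/-- The isotropy set is an embedded submanifold. -/
theorem exists_chartedSpace_isotropy (m : M) :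
    ∃ _ : ChartedSpace (EuclideanSpace ℝ (Fin (Q.isotropyDim (Q.ε m)))) (Q.isotropy m),
      IsManifold (𝓡 (Q.isotropyDim (Q.ε m))) ∞ (Q.isotropy m) ∧
      Manifold.IsSmoothEmbedding (𝓡 (Q.isotropyDim (Q.ε m))) (𝓡 n) ∞
        (Subtype.val : Q.isotropy m → G) := by
  set κ := Q.isotropyDim (Q.ε m) with hκ
  have hκβ : ∀ g, Q.β g = m → Q.isotropyDim g = κ := fun g hg => by
    rw [Q.isotropyDim_eq_unit, hg]
  have hκn : κ + d ≤ n := Q.isotropyDim_add_le _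
  -- The dimension n - d - κ is the rank of α on the source fibre: the number of further equations
  -- needed once β is fixed.
  set R := EuclideanSpace ℝ (Fin (n - d - κ))
  set B := EuclideanSpace ℝ (Fin d)
  have hdim : κ + (d + (n - d - κ)) = n := by omega
  refine exists_chartedSpace_of_zeroSet (F := B × R)
    (by simpa only [Module.finrank_prod, finrank_euclideanSpace_fin, B, R]) fun x hx => ?_
  have hxα : Q.α x = m := hx.1
  have hxβ : Q.β x = m := hx.2
  obtain ⟨φ, hφ, hmφ, hφm⟩ := exists_chart_eq_zero (E := B) m
  set U₀ : Set G := Q.α ⁻¹' φ.source ∩ Q.β ⁻¹' φ.source with hU₀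
  have hU₀o : IsOpen U₀ :=
    (φ.open_source.preimage Q.α_submersion.contMDiff.continuous).inter
      (φ.open_source.preimage Q.β_submersion.contMDiff.continuous)
  have hxU₀ : x ∈ U₀ := ⟨by rwa [mem_preimage, hxα], by rwa [mem_preimage, hxβ]⟩
  have ha : ContMDiffOn (𝓡 n) 𝓘(ℝ, B) ∞ (φ ∘ Q.α) U₀ :=
    (contMDiffOn_of_mem_maximalAtlas hφ).comp Q.α_submersion.contMDiff.contMDiffOn fun y hy => hy.1
  have hb : ContMDiffOn (𝓡 n) 𝓘(ℝ, B) ∞ (φ ∘ Q.β) U₀ :=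
    (contMDiffOn_of_mem_maximalAtlas hφ).comp Q.β_submersion.contMDiff.contMDiffOn fun y hy => hy.2
  let dφ : M → B →L[ℝ] B := fun z => mfderiv (𝓡 d) 𝓘(ℝ, B) φ z
  have hdφ : ∀ z ∈ φ.source, HasMFDerivAt (𝓡 d) 𝓘(ℝ, B) φ z (dφ z) := fun z hz =>
    ((contMDiffAt_of_mem_maximalAtlas hφ hz).mdifferentiableAt (by simp)).hasMFDerivAt
  have hdφb : ∀ z ∈ φ.source, Function.Bijective (dφ z) := fun z hz =>
    mfderiv_bijective_of_mem_maximalAtlas hφ hz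
  let da : G → EuclideanSpace ℝ (Fin n) →L[ℝ] B := fun y => (dφ (Q.α y)).comp (Q.dα y)
  let db : G → EuclideanSpace ℝ (Fin n) →L[ℝ] B := fun y => (dφ (Q.β y)).comp (Q.dβ y)
  have hda : ∀ y ∈ U₀, HasMFDerivAt (𝓡 n) 𝓘(ℝ, B) (φ ∘ Q.α) y (da y) := fun y hy =>
    (hdφ _ hy.1).comp y (Q.hasMFDerivAt_α y)
  have hdb : ∀ y ∈ U₀, HasMFDerivAt (𝓡 n) 𝓘(ℝ, B) (φ ∘ Q.β) y (db y) := fun y hy =>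
    (hdφ _ hy.2).comp y (Q.hasMFDerivAt_β y)
  -- Passing to the coordinates φ changes no kernel.
  have hker : ∀ y ∈ U₀, LinearMap.ker (da y).toLinearMap ⊓ LinearMap.ker (db y).toLinearMap =
      LinearMap.ker (Q.dα y).toLinearMap ⊓ LinearMap.ker (Q.dβ y).toLinearMap := by
    intro y hy
    ext v
    have h1 : dφ (Q.α y) (Q.dα y v) = 0 ↔ Q.dα y v = 0 :=
      map_eq_zero_iff _ (hdφb _ hy.1).1
    have h2 : dφ (Q.β y) (Q.dβ y v) = 0 ↔ Q.dβ y v = 0 :=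
      map_eq_zero_iff _ (hdφb _ hy.2).1
    exact and_congr h1 h2
  obtain ⟨P, hP⟩ := ContinuousLinearMap.exists_prod_comp_surjective (R := R) (da x) (db x)
    ((hdφb _ hxU₀.2).2.comp (Q.dβ_surjective x)) (by
      rw [hker x hxU₀]
      change Q.isotropyDim x + _ = _
      simpa only [hκβ x hxβ, finrank_euclideanSpace_fin, B, R])
  set f : G → B × R := fun y => (φ (Q.β y), P (φ (Q.α y))) with hf
  have hfs : ContMDiffOn (𝓡 n) 𝓘(ℝ, B × R) ∞ f U₀ :=
    hb.prodMk_space (P.contMDiff.comp_contMDiffOn ha)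
  have hdf : ∀ y ∈ U₀, HasMFDerivAt (𝓡 n) 𝓘(ℝ, B × R) f y ((db y).prod (P.comp (da y))) :=
    fun y hy => by
      have hPa := P.hasMFDerivAt.comp y (hda y hy)
      exact ⟨(hdb y hy).1.prodMk hPa.1, (hdb y hy).2.prodMk hPa.2⟩
  have hfsurj : Function.Surjective (mfderiv (𝓡 n) 𝓘(ℝ, B × R) f x) := by
    rw [(hdf x hxU₀).mfderiv]; exact hP
  have hmem : ∀ y ∈ Q.isotropy m, f y = 0 := fun y hy => by
    have h1 : Q.α y = m := hy.1
    have h2 : Q.β y = m := hy.2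
    simp [hf, h1, h2, hφm]
  obtain ⟨U₁, hU₁, hU₁o, hxU₁⟩ :=
    eventually_nhds_iff.mp (eventually_surjective_mfderiv hU₀o hxU₀ hfs hfsurj)
  have hβm : ∀ y ∈ U₀, f y = 0 → Q.β y = m := fun y hy hfy =>
    φ.injOn hy.2 hmφ ((congrArg Prod.fst hfy).trans hφm.symm)
  -- The constant-rank argument. At a zero y of f one has β(y) = m, so the common kernel has
  -- dimension κ there; near x the map f is a submersion, so its kernel has dimension κ too, and the
  -- obvious inclusion is an equality.
  have hloc : ∀ᶠ y in 𝓝 x, f y = 0 → (φ ∘ Q.α) y = (φ ∘ Q.α) x := by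
    refine eventually_eq_of_ker_mfderiv_le (hU₀o.inter hU₁o) ⟨hxU₀, hxU₁⟩
      (hfs.mono inter_subset_left) (ha.mono inter_subset_left) hfsurj (hmem x hx) ?_
    rintro y ⟨hy₀, hy₁⟩ hfy v hv
    rw [(hdf y hy₀).mfderiv] at hv
    rw [(hda y hy₀).mfderiv]
    have hs : Function.Surjective ((db y).prod (P.comp (da y))) := by
      have := hU₁ y hy₁
      rwa [(hdf y hy₀).mfderiv] at this
    have h1 := ContinuousLinearMap.finrank_ker_of_surjective hs
    rw [Module.finrank_prod, finrank_euclideanSpace_fin, finrank_euclideanSpace_fin,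
      finrank_euclideanSpace_fin] at h1
    have h2 : Module.finrank ℝ (LinearMap.ker (da y).toLinearMap ⊓
        LinearMap.ker (db y).toLinearMap : Submodule ℝ (EuclideanSpace ℝ (Fin n))) = κ := by
      rw [hker y hy₀]
      exact hκβ y (hβm y hy₀ hfy)
    have h3 : LinearMap.ker (da y).toLinearMap ⊓ LinearMap.ker (db y).toLinearMap =
        LinearMap.ker ((db y).prod (P.comp (da y))).toLinearMap := by
      refine Submodule.eq_of_le_of_finrank_eq ?_ (by omega)
      rintro w ⟨hw1, hw2⟩
      have hw1' : da y w = 0 := hw1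
      have hw2' : db y w = 0 := hw2
      exact Prod.ext hw2' (by simp [hw1'])
    have h4 : v ∈ LinearMap.ker (da y).toLinearMap ⊓ LinearMap.ker (db y).toLinearMap := by
      rw [h3]; exact hv
    exact h4.1
  obtain ⟨U₂, hU₂, hU₂o, hxU₂⟩ := eventually_nhds_iff.mp hloc
  refine ⟨U₀ ∩ U₂, f, hU₀o.inter hU₂o, ⟨hxU₀, hxU₂⟩, hfs.mono inter_subset_left, hfsurj, ?_⟩
  rintro y ⟨hy₀, hy₂⟩
  refine ⟨hmem y, fun hfy => ⟨?_, hβm y hy₀ hfy⟩⟩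
  have : φ (Q.α y) = φ (Q.α x) := hU₂ y hy₂ hfy
  -- The discarded coordinates of α are recovered from local constancy: α(y) = α(x) = m.
  exact (φ.injOn hy₀.1 hxU₀.1 this).trans hxα

end Isotropy

end SmoothInverseQuasiloopoid

theorem mainTheorem7 {n d : ℕ} {G M : Type*}
    [TopologicalSpace G] [T2Space G] [SecondCountableTopology G]
    [ChartedSpace (EuclideanSpace ℝ (Fin n)) G] [IsManifold (𝓡 n) ∞ G]
    [TopologicalSpace M] [T2Space M] [SecondCountableTopology M]
    [ChartedSpace (EuclideanSpace ℝ (Fin d)) M] [IsManifold (𝓡 d) ∞ M]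
    (Q : SmoothInverseQuasiloopoid n d G M) (m : M) :
    -- the restriction of the target map to the source fibre over `m` has constant rank
    (∃ (l : ℕ) (_ : ChartedSpace (EuclideanSpace ℝ (Fin l)) (Q.sourceFiber m)),
      IsManifold (𝓡 l) ∞ (Q.sourceFiber m) ∧
      Manifold.IsSmoothEmbedding (𝓡 l) (𝓡 n) ∞ (Subtype.val : Q.sourceFiber m → G) ∧
      HasConstantRank (𝓡 l) (𝓡 d) (fun g : Q.sourceFiber m => Q.α g)) ∧
    -- the isotropy set is an embedded submanifold and, with the inherited operations,
    -- a smooth inverse loop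
    (∃ (k : ℕ) (_ : ChartedSpace (EuclideanSpace ℝ (Fin k)) (Q.isotropy m)),
      IsManifold (𝓡 k) ∞ (Q.isotropy m) ∧
      Manifold.IsSmoothEmbedding (𝓡 k) (𝓡 n) ∞ (Subtype.val : Q.isotropy m → G) ∧
      ∃ (mul : Q.isotropy m → Q.isotropy m → Q.isotropy m) (e : Q.isotropy m)
        (inv : Q.isotropy m → Q.isotropy m),
        (∀ a b, (mul a b : G) = Q.mul a b) ∧ (e : G) = Q.ε m ∧ (∀ a, (inv a : G) = Q.inv a) ∧
        IsSmoothInverseLoop (𝓡 k) mul e inv) := by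
  have hk : n - d + d = n := Nat.sub_add_cancel (Q.dim_le m)
  obtain ⟨cs, hM, hι⟩ := Q.β_submersion.exists_chartedSpace_fiber hk m
  obtain ⟨cs', hM', hι'⟩ := Q.exists_chartedSpace_isotropy m
  let _ : ChartedSpace (EuclideanSpace ℝ (Fin (n - d))) (Q.sourceFiber m) := cs
  exact ⟨⟨n - d, cs, hM, hι, Q.hasConstantRank_sourceFiber m hk hι⟩,
    _, cs', hM', hι', _, _, _, fun _ _ => rfl, rfl, fun _ => rfl,
    Q.isSmoothInverseLoop_isotropy m hι'⟩
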